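/- Let $\mathrm{Domb}(n)=\sum_{k=0}^{n}\binom{n}{k}^2\binom{2k}{k}\binom{2n-2k}{n-k}$ denote the Domb numbers, and let the Euler numbers $E_n$ be defined by $\frac{2}{e^x+e^{-x}}=\sum_{n=0}^{\infty}E_n\frac{x^n}{n!}$. For rational numbers $a,b$ and a positive integer $m$, write $a\equiv b\pmod{m}$ if $(a-b)/m$ is a rational number whose denominator in lowest terms is coprime to $m$. Then for every prime $p\ge 5$, $$\sum_{k=0}^{p-1}\frac{3k+2}{(-2)^k}\,\mathrm{Domb}(k)\equiv 2p(-1)^{\frac{p-1}{2}}+6p^3E_{p-3}\pmod{p^4}.$$ -/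

import Mathlib

/-- The Domb numbers. -/
def domb (n : ℕ) : ℕ :=
  ∑ k ∈ Finset.range (n + 1),
    n.choose k ^ 2 * (2 * k).choose k * (2 * n - 2 * k).choose (n - k)

/-- The Euler numbers: `2 / (e ^ x + e ^ (-x)) = ∑ E_n x ^ n / n!` as formal power series. -/
noncomputable def eulerNumber (n : ℕ) : ℚ :=
  (n.factorial : ℚ) * PowerSeries.coeff n
    (2 * (PowerSeries.exp ℚ + PowerSeries.evalNegHom (PowerSeries.exp ℚ))⁻¹)

/-- Congruence of rational numbers modulo a positive integer `m`: the difference equals `m`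
times a fraction whose denominator is coprime to `m`. -/
def RatModEq (m : ℕ) (x y : ℚ) : Prop :=
  ∃ z : ℚ, z.den.Coprime m ∧ x - y = (m : ℚ) * z

/-! The Domb numbers have a second form, Domb(n) = ∑_j (n+j)!/((n-2j)! j!^3) C(2j,j) 4^(n-2j)
(`domb_eq_sum_dombTerm`), proved by showing that both sides satisfy the same three-term recurrence.
In this form the sum over k telescopes for each fixed j (`sum_linear_mul_pow_mul_tri`), because the
weight 3k+2 equals 2(k+1+j) + (k-2j).

With p = 2m+1, what remains is p 2^p ∑_j h_j ∏_{i≤j} (1+p/i)(1-p/(2i)), where h_j = (-1)^j C(m,j)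
C(2j,j)/4^j (`tri_summand_eq`). Since (1+x)(1-x/2)^2 = 1 - 3x^2/4 + x^3/4, modulo p^3 the product is
Q_j - (3/4) p^2 H_j, with Q_j = ∏_{i≤j} (1-p/(2i))^(-1) and H_j = ∑_{i≤j} 1/i^2.

Chu-Vandermonde sums the Q part exactly to (-1)^m Q_m, and 4^m Q_m ≡ 1 mod p^3. In the H part only
residues mod p matter: h_j becomes a shifted Legendre coefficient, the sum becomes an alternating
sum of 1/i^2 for i ≤ m, and that is 2(-1)^m E_{p-3} mod p. The outer factor p lifts the modulus to
p^4. -/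

theorem Nat.cast_descFactorial_succ_rat (N r : ℕ) :
    (N.descFactorial (r + 1) : ℚ) = (N - r) * N.descFactorial r := by
  rw [Nat.descFactorial_succ]
  rcases le_or_gt r N with h | h
  · push_cast [Nat.cast_sub h]; rfl
  · simp [Nat.descFactorial_of_lt h]

/-! ### Trinomial quotients and the telescoping sum -/

/-- The trinomial-type quotient `(n + j)! / ((n - 2 * j)! * j! ^ 3)`, zero for `n < 2 * j`. -/
def tri (n j : ℕ) : ℚ := (n + j).descFactorial (3 * j) / (j.factorial : ℚ) ^ 3

theorem tri_zero_right (n : ℕ) : tri n 0 = 1 := by simp [tri]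

theorem tri_eq_zero {n j : ℕ} (h : n < 2 * j) : tri n j = 0 := by
  simp [tri, Nat.descFactorial_of_lt (show n + j < 3 * j by omega)]

theorem tri_succ_right (n j : ℕ) :
    tri n (j + 1) * ((j : ℚ) + 1) ^ 3 = (n + 1 + j) * (n - 2 * j) * (n - 2 * j - 1) * tri n j := by
  have hj : ((j.factorial : ℕ) : ℚ) ≠ 0 := by exact_mod_cast j.factorial_ne_zero
  have hj' : ((j : ℚ) + 1) ≠ 0 := by positivity
  have h1 : ((n + (j + 1)).descFactorial (3 * (j + 1)) : ℚ)
      = (n + 1 + j) * ((n - 2 * j - 1) * ((n - 2 * j) * (n + j).descFactorial (3 * j))) := by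
    rw [show n + (j + 1) = (n + j) + 1 by ring, show 3 * (j + 1) = (3 * j + 1 + 1) + 1 by ring,
      Nat.succ_descFactorial_succ, Nat.cast_mul, Nat.cast_descFactorial_succ_rat,
      Nat.cast_descFactorial_succ_rat]
    push_cast
    ring
  rw [tri, tri, h1, Nat.factorial_succ]
  push_cast
  field_simp

theorem tri_succ_left (n j : ℕ) :
    tri (n + 1) j * (n + 1 - 2 * j) = (n + 1 + j) * tri n j := by
  have h : ((n + 1 + j).descFactorial (3 * j) : ℚ) * (n + 1 - 2 * j)
      = (n + 1 + j) * (n + j).descFactorial (3 * j) := by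
    have h1 := Nat.cast_descFactorial_succ_rat (n + 1 + j) (3 * j)
    rw [show n + 1 + j = (n + j) + 1 by ring, Nat.succ_descFactorial_succ] at h1
    rw [show n + 1 + j = (n + j) + 1 by ring]
    push_cast at h1 ⊢
    linear_combination -h1
  rw [tri, tri, div_mul_eq_mul_div, h, mul_div_assoc]

/-- Solved for the smaller index because n+1+j never vanishes, whereas n+1-2j may. -/
theorem tri_eq_tri_succ (n j : ℕ) :
    tri n j = (n + 1 - 2 * j) / (n + 1 + j) * tri (n + 1) j := by
  have h : ((n : ℚ) + 1 + j) ≠ 0 := by positivity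
  have := tri_succ_left n j
  field_simp
  linear_combination -this

/-- By `tri_succ_left` the right side increases by (-2)^n (2(n+1+j) + (n-2j)) `tri n j`, and j
cancels in the bracket. -/
theorem sum_linear_mul_pow_mul_tri (n j : ℕ) :
    ∑ k ∈ Finset.range n, (3 * (k : ℚ) + 2) * (-2) ^ k * tri k j
      = -(-2) ^ n * (n - 2 * j) * tri n j := by
  induction n with
  | zero =>
    rcases Nat.eq_zero_or_pos j with rfl | h
    · simp
    · simp [tri_eq_zero (show 0 < 2 * j by omega)]
  | succ n ih =>
    rw [Finset.sum_range_succ, ih]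
    push_cast
    linear_combination (2 * (-2) ^ n : ℚ) * -tri_succ_left n j

/-! ### Recurrences and the single-sum formula for Domb numbers -/

theorem centralBinom_succ_rat (k : ℕ) :
    ((k + 1).centralBinom : ℚ) = 2 * (2 * k + 1) / (k + 1) * k.centralBinom := by
  have h := Nat.succ_mul_centralBinom_succ k
  have h' : ((k : ℚ) + 1) * (k + 1).centralBinom = 2 * (2 * k + 1) * k.centralBinom := by
    exact_mod_cast h
  have : ((k : ℚ) + 1) ≠ 0 := by positivity
  field_simp
  linear_combination h'

/-- The summand of the single-sum formula for the Domb numbers. -/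
def dombTerm (n j : ℕ) : ℚ := tri n j * j.centralBinom * 4 ^ n / 16 ^ j

theorem dombTerm_eq_zero {n j : ℕ} (h : n < 2 * j) : dombTerm n j = 0 := by
  simp [dombTerm, tri_eq_zero h]

/-- A Zeilberger certificate: the right side is the antidifference in K, and it vanishes at K = 0
and once 2K > n+2. -/
theorem dombTerm_telescope (n K : ℕ) :
    ∑ j ∈ Finset.range K, (((n : ℚ) + 2) ^ 3 * dombTerm (n + 2) j
      - 2 * (2 * n + 3) * (5 * n ^ 2 + 15 * n + 12) * dombTerm (n + 1) j
      + 64 * (n + 1) ^ 3 * dombTerm n j)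
      = -192 * (3 * n + 4) * K ^ 4 * tri (n + 2) K * K.centralBinom * 4 ^ n / 16 ^ K
        / ((n + 1 + K) * (n + 2 + K)) := by
  induction K with
  | zero => simp
  | succ j ih =>
    rw [Finset.sum_range_succ, ih]
    have hj : ((j : ℚ) + 1) ≠ 0 := by positivity
    have e3 : tri (n + 2) (j + 1) = ((n + 2 : ℕ) + 1 + j) * ((n + 2 : ℕ) - 2 * j)
        * ((n + 2 : ℕ) - 2 * j - 1) / ((j : ℚ) + 1) ^ 3 * tri (n + 2) j := by
      have := tri_succ_right (n + 2) j
      field_simp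
      linear_combination this
    simp only [dombTerm]
    rw [tri_eq_tri_succ n j, tri_eq_tri_succ (n + 1) j, e3, centralBinom_succ_rat]
    push_cast
    have h1 : ((n : ℚ) + 1 + j) ≠ 0 := by positivity
    have h2 : ((n : ℚ) + 2 + j) ≠ 0 := by positivity
    have h3 : ((n : ℚ) + 3 + j) ≠ 0 := by positivity
    rw [show ((n : ℚ) + 1 + 1 + j) = n + 2 + j by ring, show ((n : ℚ) + 2 + 1 + j) = n + 3 + j by ring,
      show ((n : ℚ) + 1 + (j + 1)) = n + 2 + j by ring,
      show ((n : ℚ) + 2 + (j + 1)) = n + 3 + j by ring, show n + 1 + 1 = n + 2 from rfl]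
    field_simp
    ring

theorem sum_dombTerm_of_le {n M : ℕ} (h : n < M) :
    ∑ j ∈ Finset.range M, dombTerm n j = ∑ j ∈ Finset.range (n + 1), dombTerm n j := by
  symm
  apply Finset.sum_subset (Finset.range_subset_range.2 h)
  intro j _ hj
  rw [Finset.mem_range] at hj
  exact dombTerm_eq_zero (by omega)

theorem sum_dombTerm_rec (n : ℕ) :
    ((n : ℚ) + 2) ^ 3 * ∑ j ∈ Finset.range (n + 3), dombTerm (n + 2) j
      = 2 * (2 * n + 3) * (5 * n ^ 2 + 15 * n + 12) * ∑ j ∈ Finset.range (n + 2), dombTerm (n + 1) j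
      - 64 * (n + 1) ^ 3 * ∑ j ∈ Finset.range (n + 1), dombTerm n j := by
  have h := dombTerm_telescope n (n + 3)
  rw [tri_eq_zero (show n + 2 < 2 * (n + 3) by omega), Finset.sum_add_distrib,
    Finset.sum_sub_distrib, ← Finset.mul_sum, ← Finset.mul_sum, ← Finset.mul_sum,
    sum_dombTerm_of_le (show n < n + 3 by omega),
    sum_dombTerm_of_le (show n + 1 < n + 3 by omega)] at h
  linear_combination h

/-- The coefficients `C(2k, k) / k! ^ 2`. -/
def cbf (k : ℕ) : ℚ := k.centralBinom / (k.factorial : ℚ) ^ 2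

theorem cbf_succ (k : ℕ) : cbf (k + 1) = 2 * (2 * k + 1) / (k + 1) ^ 3 * cbf k := by
  have : ((k : ℚ) + 1) ≠ 0 := by positivity
  have hk : ((k.factorial : ℕ) : ℚ) ≠ 0 := by exact_mod_cast k.factorial_ne_zero
  rw [cbf, cbf, centralBinom_succ_rat, Nat.factorial_succ]
  push_cast
  field_simp

/-- Splitting C(n,k)^2 into factorials makes Domb(n)/n!^2 a self-convolution, whose summand has
simple shift ratios. -/
theorem domb_eq_sum_cbf (n : ℕ) :
    (domb n : ℚ) = (n.factorial : ℚ) ^ 2 * ∑ k ∈ Finset.range (n + 1), cbf k * cbf (n - k) := by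
  rw [domb, Finset.mul_sum]
  push_cast
  refine Finset.sum_congr rfl fun k hk => ?_
  have hk : k ≤ n := by simpa [Nat.lt_succ_iff] using hk
  rw [cbf, cbf, Nat.cast_choose ℚ hk, Nat.centralBinom, Nat.centralBinom,
    show 2 * n - 2 * k = 2 * (n - k) by omega]
  have h1 : ((k.factorial : ℕ) : ℚ) ≠ 0 := by exact_mod_cast k.factorial_ne_zero
  have h2 : (((n - k).factorial : ℕ) : ℚ) ≠ 0 := by exact_mod_cast (n - k).factorial_ne_zero
  field_simp

/-- The polynomial part of the certificate for the recurrence of the Domb numbers. -/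
def dombCert (n k : ℚ) : ℚ :=
  -112 + 148 * k - 60 * k ^ 2 + 8 * k ^ 3 + n * (-432 + 474 * k - 156 * k ^ 2 + 16 * k ^ 3)
    + n ^ 2 * (-652 + 556 * k - 132 * k ^ 2 + 8 * k ^ 3) + n ^ 3 * (-480 + 282 * k - 36 * k ^ 2)
    + n ^ 4 * (-172 + 52 * k) - 24 * n ^ 5

/-- The Zeilberger certificate for the defining sum; the extra squares are ratios of the n!^2. The
bound on K keeps the natural subtractions exact, so `domb_rec` adds the terms with k > n by hand. -/
theorem cbf_telescope (n K : ℕ) (hK : K ≤ n + 1) :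
    ∑ k ∈ Finset.range K, (((n : ℚ) + 2) ^ 3 * ((n + 2) ^ 2 * (n + 1) ^ 2) * (cbf k * cbf (n + 2 - k))
      - 2 * (2 * n + 3) * (5 * n ^ 2 + 15 * n + 12) * (n + 1) ^ 2 * (cbf k * cbf (n + 1 - k))
      + 64 * (n + 1) ^ 3 * (cbf k * cbf (n - k)))
      = dombCert n K * K ^ 3 * cbf K * cbf (n + 1 - K) / (n - K + 2) ^ 3 := by
  induction K with
  | zero => simp
  | succ k ih =>
    rw [Finset.sum_range_succ, ih (by omega)]
    obtain ⟨l, rfl⟩ : ∃ l, n = k + l := ⟨n - k, by omega⟩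
    rw [show k + l + 2 - k = l + 1 + 1 by omega, show k + l + 1 - k = l + 1 by omega,
      show k + l - k = l by omega, show k + l + 1 - (k + 1) = l by omega,
      cbf_succ (l + 1), cbf_succ l, cbf_succ k]
    push_cast
    rw [show ((k : ℚ) + l - k + 2) = l + 2 by ring, show ((k : ℚ) + l - (k + 1) + 2) = l + 1 by ring,
      show ((l : ℚ) + 1 + 1) = l + 2 by ring]
    have h1 : ((k : ℚ) + 1) ≠ 0 := by positivity
    have h2 : ((l : ℚ) + 1) ≠ 0 := by positivity
    have h3 : ((l : ℚ) + 2) ≠ 0 := by positivity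
    unfold dombCert
    field_simp
    ring

theorem domb_rec (n : ℕ) :
    ((n : ℚ) + 2) ^ 3 * domb (n + 2)
      = 2 * (2 * n + 3) * (5 * n ^ 2 + 15 * n + 12) * domb (n + 1) - 64 * (n + 1) ^ 3 * domb n := by
  have h := cbf_telescope n (n + 1) le_rfl
  rw [Finset.sum_add_distrib, Finset.sum_sub_distrib, ← Finset.mul_sum, ← Finset.mul_sum,
    ← Finset.mul_sum] at h
  rw [domb_eq_sum_cbf, domb_eq_sum_cbf, domb_eq_sum_cbf, Finset.sum_range_succ _ (n + 2),
    Finset.sum_range_succ _ (n + 1), Finset.sum_range_succ _ (n + 1), Nat.factorial_succ (n + 1),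
    Nat.factorial_succ n, show n + 2 - (n + 2) = 0 by omega, show n + 2 - (n + 1) = 0 + 1 by omega,
    show n + 1 - (n + 1) = 0 by omega, cbf_succ 0]
  rw [show n + 1 - (n + 1) = 0 by omega, dombCert] at h
  have c0 : cbf 0 = 1 := by simp [cbf]
  have e : cbf (n + 2) * ((n : ℚ) + 2) ^ 3 = 2 * (2 * n + 3) * cbf (n + 1) := by
    have h1 : ((n : ℚ) + 1 + 1) ≠ 0 := by positivity
    rw [cbf_succ (n + 1)]
    push_cast
    rw [show ((n : ℚ) + 2) = n + 1 + 1 by ring]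
    field_simp
    ring
  rw [c0] at h ⊢
  push_cast at h ⊢
  rw [show ((n : ℚ) - (n + 1) + 2) = 1 by ring] at h
  linear_combination (n.factorial : ℚ) ^ 2 * h
    + ((n.factorial : ℚ) * (n + 1) * (n + 2)) ^ 2 * e

theorem domb_eq_sum_dombTerm (n : ℕ) :
    (domb n : ℚ) = ∑ j ∈ Finset.range (n + 1), dombTerm n j := by
  induction n using Nat.strong_induction_on with
  | _ n ih =>
    match n, ih with
    | 0, _ => simp [domb, dombTerm, tri_zero_right]
    | 1, _ =>
      have : dombTerm 1 1 = 0 := dombTerm_eq_zero (by norm_num)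
      rw [Finset.sum_range_succ, Finset.sum_range_one, this, dombTerm, tri_zero_right]
      norm_num [domb, Finset.sum_range_succ]
    | n + 2, ih =>
      have h1 := domb_rec n
      rw [ih n (by omega), ih (n + 1) (by omega), ← sum_dombTerm_rec] at h1
      have : ((n : ℚ) + 2) ^ 3 ≠ 0 := by positivity
      exact mul_left_cancel₀ this h1

/-! ### The sum at p = 2m+1 and Chu-Vandermonde -/

theorem sum_domb_eq (p : ℕ) (hp : Odd p) :
    ∑ k ∈ Finset.range p, (3 * (k : ℚ) + 2) / (-2) ^ k * (domb k : ℚ)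
      = 2 ^ p * ∑ j ∈ Finset.range p, ((p : ℚ) - 2 * j) * tri p j * j.centralBinom / 16 ^ j := by
  have h : ∀ k ∈ Finset.range p, (3 * (k : ℚ) + 2) / (-2) ^ k * (domb k : ℚ)
      = ∑ j ∈ Finset.range p, (j.centralBinom / 16 ^ j) * ((3 * (k : ℚ) + 2) * (-2) ^ k * tri k j) := by
    intro k hk
    rw [domb_eq_sum_dombTerm, ← sum_dombTerm_of_le (Finset.mem_range.1 hk), Finset.mul_sum]
    refine Finset.sum_congr rfl fun j _ => ?_
    rw [dombTerm, show (4 : ℚ) = -2 * -2 by norm_num, mul_pow]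
    have : ((-2 : ℚ) ^ k) ≠ 0 := by positivity
    field_simp
  rw [Finset.sum_congr rfl h, Finset.sum_comm, Finset.mul_sum]
  refine Finset.sum_congr rfl fun j _ => ?_
  rw [← Finset.mul_sum, sum_linear_mul_pow_mul_tri, hp.neg_pow]
  ring

theorem choose_succ_right_rat (m j : ℕ) :
    (m.choose (j + 1) : ℚ) = (m - j) / (j + 1) * m.choose j := by
  have h : ((m.choose (j + 1) : ℕ) : ℚ) * (j + 1) = m.choose j * (m - j) := by
    rcases le_or_gt j m with h | h
    · rw [← Nat.cast_sub h]
      exact_mod_cast Nat.choose_succ_right_eq m j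
    · simp [Nat.choose_eq_zero_of_lt h, Nat.choose_eq_zero_of_lt (show m < j + 1 by omega)]
  have : ((j : ℚ) + 1) ≠ 0 := by positivity
  field_simp
  linear_combination h

theorem choose_succ_succ_rat (m j : ℕ) :
    ((m + 1).choose (j + 1) : ℚ) = (m + 1) / (j + 1) * m.choose j := by
  have h : ((m : ℚ) + 1) * m.choose j = (m + 1).choose (j + 1) * (j + 1) := by
    exact_mod_cast Nat.add_one_mul_choose_eq m j
  have : ((j : ℚ) + 1) ≠ 0 := by positivity
  field_simp
  linear_combination -h

/-- The summand of the terminating series `₂F₁(-m, 1/2; 1; 1)`. -/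
def halfTerm (m j : ℕ) : ℚ := (-1) ^ j * m.choose j * (j.centralBinom / 4 ^ j)

/-- Among the factors p-1, ..., p-2j, the p-(2i-1) = 2(m-i+1) build C(m,j) and the p-2i =
-2i(1-p/(2i)) give the second product; the p+i = i(1+p/i) give the first. -/
theorem tri_summand_eq (m j : ℕ) :
    (((2 * m + 1 : ℕ) : ℚ) - 2 * j) * tri (2 * m + 1) j * j.centralBinom / 16 ^ j
      = (2 * m + 1 : ℕ) * (halfTerm m j * ∏ i ∈ Finset.range j,
          ((1 + (2 * m + 1 : ℕ) / ((i : ℚ) + 1)) * (1 - (2 * m + 1 : ℕ) / (2 * ((i : ℚ) + 1))))) := by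
  induction j with
  | zero => simp [halfTerm, tri_zero_right]
  | succ j ih =>
    have hj : ((j : ℚ) + 1) ≠ 0 := by positivity
    have e3 : tri (2 * m + 1) (j + 1) = ((2 * m + 1 : ℕ) + 1 + j) * ((2 * m + 1 : ℕ) - 2 * j)
        * ((2 * m + 1 : ℕ) - 2 * j - 1) / ((j : ℚ) + 1) ^ 3 * tri (2 * m + 1) j := by
      have := tri_succ_right (2 * m + 1) j
      field_simp
      linear_combination this
    rw [Finset.prod_range_succ, e3, centralBinom_succ_rat]
    unfold halfTerm at ih ⊢
    rw [choose_succ_right_rat, centralBinom_succ_rat]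
    set P := ∏ i ∈ Finset.range j,
          ((1 + (2 * m + 1 : ℕ) / ((i : ℚ) + 1)) * (1 - (2 * m + 1 : ℕ) / (2 * ((i : ℚ) + 1))))
    push_cast at ih ⊢
    have e : (2 * (m : ℚ) + 1 - 2 * (j + 1)) * ((2 * m + 1 + 1 + j) * (2 * m + 1 - 2 * j)
        * (2 * m + 1 - 2 * j - 1) / (j + 1) ^ 3 * tri (2 * m + 1) j) *
        (2 * (2 * j + 1) / (j + 1) * j.centralBinom) / 16 ^ (j + 1)
        = (2 * (m : ℚ) + 1 - 2 * (j + 1)) * (2 * m + 1 + 1 + j) * (2 * m + 1 - 2 * j - 1) / (j + 1) ^ 3 *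
        (2 * (2 * j + 1) / (j + 1)) / 16 * ((2 * m + 1 - 2 * j) * tri (2 * m + 1) j * j.centralBinom / 16 ^ j) := by
      field_simp
      ring
    rw [e, ih]
    field_simp
    ring

/-- The Chu-Vandermonde identity. -/
theorem chu_vandermonde_alternating (m : ℕ) (a c : ℚ) (hc : ∀ i : ℕ, c + i ≠ 0) :
    ∑ j ∈ Finset.range (m + 1), (-1) ^ j * (m.choose j : ℚ) * ∏ i ∈ Finset.range j, (a + i) / (c + i)
      = ∏ i ∈ Finset.range m, (c - a + i) / (c + i) := by
  induction m generalizing a c with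
  | zero => simp
  | succ m ih =>
    have hc' : ∀ i : ℕ, c + 1 + i ≠ 0 := fun i => by
      have := hc (i + 1)
      push_cast at this
      rwa [add_assoc, add_comm (1 : ℚ)]
    have h1 := ih a c hc
    have h2 := ih (a + 1) (c + 1) hc'
    have key : ∀ j, ∏ i ∈ Finset.range (j + 1), (a + i) / (c + i)
        = a / c * ∏ i ∈ Finset.range j, (a + 1 + i) / (c + 1 + i) := by
      intro j
      rw [Finset.prod_range_succ', mul_comm]
      congr 1
      · simp
      · refine Finset.prod_congr rfl fun i _ => ?_
        push_cast
        ring_nf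
    rw [Finset.sum_range_succ']
    -- Pascal's rule: S_{m+1}(a,c) = S_m(a,c) - (a/c) S_m(a+1,c+1), which is why a and c are
    -- generalized.
    have h3 : ∑ j ∈ Finset.range (m + 1), (-1 : ℚ) ^ (j + 1) * ((m + 1).choose (j + 1) : ℚ) *
          ∏ i ∈ Finset.range (j + 1), (a + i) / (c + i)
        = ∑ j ∈ Finset.range (m + 1), (-1 : ℚ) ^ (j + 1) * (m.choose (j + 1) : ℚ) *
          ∏ i ∈ Finset.range (j + 1), (a + i) / (c + i)
          - a / c * ∑ j ∈ Finset.range (m + 1), (-1 : ℚ) ^ j * (m.choose j : ℚ) *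
          ∏ i ∈ Finset.range j, (a + 1 + i) / (c + 1 + i) := by
      rw [Finset.mul_sum, ← Finset.sum_sub_distrib]
      refine Finset.sum_congr rfl fun j _ => ?_
      rw [Nat.choose_succ_succ, key]
      push_cast
      ring
    have h4 := Finset.sum_range_succ' (fun j => (-1 : ℚ) ^ j * (m.choose j : ℚ) *
          ∏ i ∈ Finset.range j, (a + i) / (c + i)) (m + 1)
    rw [Finset.sum_range_succ, h1] at h4
    simp only [Nat.choose_succ_self, Nat.cast_zero, mul_zero, zero_mul, add_zero] at h4
    have h5 : ∏ i ∈ Finset.range m, (c + 1 - (a + 1) + i) / (c + 1 + i)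
        = (∏ i ∈ Finset.range m, (c - a + i) / (c + i)) * (c / (c + m)) := by
      clear ih h1 h2 h3 h4 key
      have hc0 : c ≠ 0 := by simpa using hc 0
      induction m with
      | zero => simp [hc0]
      | succ m ihm =>
        rw [Finset.prod_range_succ, Finset.prod_range_succ, ihm]
        have := hc m
        have := hc' m
        have h' := hc (m + 1)
        push_cast at h' ⊢
        rw [show c + 1 + (m : ℚ) = c + (m + 1) by ring]
        field_simp
        ring
    have hm := hc m
    have hc0 : c ≠ 0 := by simpa using hc 0
    rw [h3, h2, h5, Finset.prod_range_succ]
    simp only [Nat.choose_zero_right] at h4 ⊢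
    have : (∏ i ∈ Finset.range m, (c - a + i) / (c + i)) * ((c - a + m) / (c + m))
        = (∏ i ∈ Finset.range m, (c - a + i) / (c + i))
          - a / c * ((∏ i ∈ Finset.range m, (c - a + i) / (c + i)) * (c / (c + m))) := by
      field_simp
      ring
    rw [this]
    linear_combination -h4

theorem two_mul_succ_sub_odd_ne_zero (m i : ℕ) : (2 * ((i : ℚ) + 1) - (2 * m + 1 : ℕ)) ≠ 0 := by
  intro h
  have : (2 * (i + 1) : ℕ) = 2 * m + 1 := by
    have : ((2 * (i + 1) : ℕ) : ℚ) = (2 * m + 1 : ℕ) := by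
      push_cast at h ⊢
      linarith
    exact_mod_cast this
  omega

theorem one_sub_half_ne_zero (m i : ℕ) : (1 - (2 * m + 1 : ℕ) / (2 * ((i : ℚ) + 1))) ≠ 0 := by
  have h := two_mul_succ_sub_odd_ne_zero m i
  have hi : ((i : ℚ) + 1) ≠ 0 := by positivity
  rw [one_sub_div (by positivity)]
  exact div_ne_zero h (by positivity)

theorem inv_one_sub_half (m i : ℕ) : (1 - (2 * m + 1 : ℕ) / (2 * ((i : ℚ) + 1)))⁻¹
    = 2 * ((i : ℚ) + 1) / (2 * ((i : ℚ) + 1) - (2 * m + 1 : ℕ)) := by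
  rw [one_sub_div (by positivity), inv_div]

theorem centralBinom_div_four_pow (j : ℕ) :
    (j.centralBinom : ℚ) / 4 ^ j = ∏ i ∈ Finset.range j, (2 * (i : ℚ) + 1) / (2 * (i + 1)) := by
  induction j with
  | zero => simp
  | succ j ih =>
    rw [Finset.prod_range_succ, ← ih, centralBinom_succ_rat]
    have : ((j : ℚ) + 1) ≠ 0 := by positivity
    field_simp
    ring

/-- The inverse of `∏ (1 - p / (2 * i))`, where `1 ≤ i ≤ j` and `p = 2 * m + 1`. -/
def invProd (m j : ℕ) : ℚ :=
  ∏ i ∈ Finset.range j, (1 - (2 * m + 1 : ℕ) / (2 * ((i : ℚ) + 1)))⁻¹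

/-- Chu-Vandermonde with a = 1/2, c = 1-p/2: the j! in (1/2)_j/j! and j!/(1-p/2)_j cancel, and c-a =
-m. -/
theorem sum_halfTerm_mul_invProd (m : ℕ) :
    ∑ j ∈ Finset.range (m + 1), halfTerm m j * invProd m j = (-1) ^ m * invProd m m := by
  have hne := two_mul_succ_sub_odd_ne_zero m
  have hc : ∀ i : ℕ, (1 - (2 * m + 1 : ℕ) / 2 : ℚ) + i ≠ 0 := fun i h => by
    apply hne i
    linear_combination 2 * h
  have h := chu_vandermonde_alternating m (1 / 2) (1 - (2 * m + 1 : ℕ) / 2) hc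
  have hterm : ∀ i : ℕ, ((1 : ℚ) / 2 + i) / (1 - (2 * m + 1 : ℕ) / 2 + i)
      = (2 * (i : ℚ) + 1) / (2 * (i + 1)) * (1 - (2 * m + 1 : ℕ) / (2 * ((i : ℚ) + 1)))⁻¹ := by
    intro i
    have hi : ((i : ℚ) + 1) ≠ 0 := by positivity
    have h1 := hne i
    rw [inv_one_sub_half,
      show (1 - (2 * m + 1 : ℕ) / 2 + (i : ℚ)) = (2 * ((i : ℚ) + 1) - (2 * m + 1 : ℕ)) / 2 by ring]
    field_simp
    ring
  simp only [hterm, Finset.prod_mul_distrib, ← centralBinom_div_four_pow] at h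
  simp only [halfTerm, invProd]
  simp only [← mul_assoc] at h ⊢
  rw [h]
  have hterm' : ∀ i : ℕ, ((1 - (2 * m + 1 : ℕ) / 2 : ℚ) - 1 / 2 + i) / (1 - (2 * m + 1 : ℕ) / 2 + i)
      = (-1) * ((m - i : ℚ) / (i + 1)) * (1 - (2 * m + 1 : ℕ) / (2 * ((i : ℚ) + 1)))⁻¹ := by
    intro i
    have hi : ((i : ℚ) + 1) ≠ 0 := by positivity
    have h1 := hne i
    rw [inv_one_sub_half,
      show (1 - (2 * m + 1 : ℕ) / 2 + (i : ℚ)) = (2 * ((i : ℚ) + 1) - (2 * m + 1 : ℕ)) / 2 by ring]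
    field_simp
    push_cast
    ring
  simp only [hterm', Finset.prod_mul_distrib, Finset.prod_const, Finset.card_range,
    Finset.prod_div_distrib]
  have : ∏ i ∈ Finset.range m, ((m : ℚ) - i) = ∏ i ∈ Finset.range m, ((i : ℚ) + 1) := by
    rw [← Finset.prod_range_reflect]
    refine Finset.prod_congr rfl fun i hi => ?_
    have hi := Finset.mem_range.1 hi
    rw [Nat.sub_sub, Nat.cast_sub (by omega)]
    push_cast
    ring
  have hpos : ∏ i ∈ Finset.range m, ((i : ℚ) + 1) ≠ 0 :=
    Finset.prod_ne_zero_iff.2 fun i _ => by positivity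
  rw [this, div_self hpos, mul_one]

theorem prod_range_add_eq_two_pow_mul (m : ℕ) :
    ∏ i ∈ Finset.range m, ((m : ℚ) + 1 + i) = 2 ^ m * ∏ i ∈ Finset.range m, (2 * (i : ℚ) + 1) := by
  induction m with
  | zero => simp
  | succ m ih =>
    have h := Finset.prod_range_succ' (fun i : ℕ => (m : ℚ) + 1 + i) (m + 1)
    rw [Finset.prod_range_succ, Finset.prod_range_succ, ih] at h
    have e : ∏ i ∈ Finset.range (m + 1), (((m + 1 : ℕ) : ℚ) + 1 + i)
        = ∏ i ∈ Finset.range (m + 1), ((m : ℚ) + 1 + (i + 1 : ℕ)) :=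
      Finset.prod_congr rfl fun i _ => by push_cast; ring
    have hm : ((m : ℚ) + 1) ≠ 0 := by positivity
    rw [e, Finset.prod_range_succ (fun i : ℕ => 2 * (i : ℚ) + 1)]
    apply mul_right_cancel₀ hm
    push_cast at h ⊢
    linear_combination -h

/-- The first product is (-1)^m C(2m,m), the second (-1)^m 2^m m!/(1·3···(2m-1)). -/
theorem four_pow_eq (m : ℕ) :
    (4 : ℚ) ^ m = (∏ i ∈ Finset.range m, (1 - (2 * m + 1 : ℕ) / ((i : ℚ) + 1))) * invProd m m := by
  have h1 : ∏ i ∈ Finset.range m, (1 - (2 * m + 1 : ℕ) / ((i : ℚ) + 1))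
      = (∏ i ∈ Finset.range m, ((m : ℚ) + 1 + i)) * (-1) ^ m
        / ∏ i ∈ Finset.range m, ((i : ℚ) + 1) := by
    rw [← Finset.prod_range_reflect (fun i : ℕ => (m : ℚ) + 1 + i), eq_div_iff
      (Finset.prod_ne_zero_iff.2 fun i _ => by positivity), ← Finset.prod_mul_distrib]
    have : (-1 : ℚ) ^ m = ∏ i ∈ Finset.range m, (-1 : ℚ) := by simp
    rw [this, ← Finset.prod_mul_distrib]
    refine Finset.prod_congr rfl fun i hi => ?_
    have hi := Finset.mem_range.1 hi
    have : ((i : ℚ) + 1) ≠ 0 := by positivity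
    rw [Nat.sub_sub, Nat.cast_sub (by omega)]
    push_cast
    field_simp
    ring
  have h2 : invProd m m = 2 ^ m * (∏ i ∈ Finset.range m, ((i : ℚ) + 1)) * (-1) ^ m
      / ∏ i ∈ Finset.range m, (2 * (i : ℚ) + 1) := by
    have : (-1 : ℚ) ^ m = ∏ i ∈ Finset.range m, (-1 : ℚ) := by simp
    have t : (2 : ℚ) ^ m = ∏ i ∈ Finset.range m, (2 : ℚ) := by simp
    rw [invProd, ← Finset.prod_range_reflect (fun i : ℕ => 2 * (i : ℚ) + 1), this, t, eq_div_iff,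
      ← Finset.prod_mul_distrib, ← Finset.prod_mul_distrib, ← Finset.prod_mul_distrib]
    · refine Finset.prod_congr rfl fun i hi => ?_
      have hi := Finset.mem_range.1 hi
      have h1 := two_mul_succ_sub_odd_ne_zero m i
      have : ((i : ℚ) + 1) ≠ 0 := by positivity
      rw [Nat.sub_sub, Nat.cast_sub (by omega), inv_one_sub_half]
      field_simp
      push_cast
      ring
    · exact Finset.prod_ne_zero_iff.2 fun i _ => by positivity
  have hA : ∏ i ∈ Finset.range m, ((i : ℚ) + 1) ≠ 0 :=
    Finset.prod_ne_zero_iff.2 fun i _ => by positivity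
  have hB : ∏ i ∈ Finset.range m, (2 * (i : ℚ) + 1) ≠ 0 :=
    Finset.prod_ne_zero_iff.2 fun i _ => by positivity
  have hs : ((-1 : ℚ) ^ m) * (-1) ^ m = 1 := by rw [← mul_pow]; norm_num
  rw [h1, h2, prod_range_add_eq_two_pow_mul]
  field_simp
  rw [show (4 : ℚ) = 2 * 2 by norm_num, mul_pow]
  linear_combination (-(2 : ℚ) ^ m * 2 ^ m) * hs

/-! ### A Legendre sum weighted by harmonic numbers -/

/-- The coefficients of the shifted Legendre polynomial of degree `m`. -/
def legendreTerm (m j : ℕ) : ℚ := (-1) ^ j * m.choose j * (m + j).choose j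

/-- The partial sums of `∑ 1 / i ^ 2`. -/
def harmonicSq (j : ℕ) : ℚ := ∑ i ∈ Finset.range j, 1 / ((i : ℚ) + 1) ^ 2

/-- The partial sums of `∑ (-1) ^ i / i ^ 2`. -/
def altHarmonicSq (j : ℕ) : ℚ := ∑ i ∈ Finset.range j, (-1) ^ (i + 1) / ((i : ℚ) + 1) ^ 2

theorem legendreTerm_succ_right (m k : ℕ) :
    legendreTerm m (k + 1) = -((m - k) * (m + k + 1) / (k + 1) ^ 2) * legendreTerm m k := by
  have : ((k : ℚ) + 1) ≠ 0 := by positivity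
  rw [legendreTerm, legendreTerm, choose_succ_right_rat, ← add_assoc, choose_succ_succ_rat]
  push_cast
  field_simp
  ring

theorem legendreTerm_succ_succ (m k : ℕ) :
    legendreTerm (m + 1) (k + 1)
      = -((m + k + 2) * (m + k + 1) / (k + 1) ^ 2) * legendreTerm m k := by
  have : ((k : ℚ) + 1) ≠ 0 := by positivity
  have hm : ((m : ℚ) + 1) ≠ 0 := by positivity
  have h : ((m + k + 1).choose k : ℚ) = (m + k + 1) / (m + 1) * (m + k).choose k := by
    have h := Nat.choose_mul_succ_eq (m + k) k
    rw [show m + k + 1 - k = m + 1 by omega] at h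
    have h' : ((m + k).choose k : ℚ) * (m + k + 1) = (m + k + 1).choose k * (m + 1) := by
      exact_mod_cast h
    field_simp
    linear_combination -h'
  rw [legendreTerm, legendreTerm, choose_succ_succ_rat, show m + 1 + (k + 1) = m + k + 1 + 1 by ring,
    choose_succ_succ_rat, h]
  push_cast
  field_simp
  ring

/-- Adding consecutive degrees makes the summand summable in closed form in k. -/
theorem sum_legendreTerm_add_mul_harmonicSq (m k : ℕ) :
    ∑ j ∈ Finset.range (k + 1), (legendreTerm (m + 1) j + legendreTerm m j) * harmonicSq j
      = 2 / (m + 1) * ((-(m + 1) + (m + k + 1) * legendreTerm m k) / (m + 1) ^ 2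
        + (m + k + 1) * legendreTerm m k * harmonicSq k) := by
  have hm : ((m : ℚ) + 1) ≠ 0 := by positivity
  induction k with
  | zero => simp [harmonicSq, legendreTerm]
  | succ k ih =>
    have : ((k : ℚ) + 1) ≠ 0 := by positivity
    have hH : harmonicSq (k + 1) = harmonicSq k + 1 / ((k : ℚ) + 1) ^ 2 := by
      simp only [harmonicSq, Finset.sum_range_succ]
    rw [Finset.sum_range_succ, ih, legendreTerm_succ_succ, legendreTerm_succ_right, hH]
    push_cast
    field_simp
    ring

theorem legendreTerm_eq_zero {m j : ℕ} (h : m < j) : legendreTerm m j = 0 := by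
  simp [legendreTerm, Nat.choose_eq_zero_of_lt h]

theorem sum_legendreTerm_mul_harmonicSq (m : ℕ) :
    ∑ j ∈ Finset.range (m + 1), legendreTerm m j * harmonicSq j
      = (-1) ^ (m + 1) * 2 * altHarmonicSq m := by
  induction m with
  | zero => simp [harmonicSq, altHarmonicSq]
  | succ m ih =>
    have hm : ((m : ℚ) + 1) ≠ 0 := by positivity
    -- At this bound both sums are complete and the Legendre term on the right vanishes, leaving
    -- S_{m+1} + S_m = -2/(m+1)^2.
    have h := sum_legendreTerm_add_mul_harmonicSq m (m + 1)
    simp only [add_mul, Finset.sum_add_distrib] at h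
    rw [Finset.sum_range_succ (fun j => legendreTerm m j * harmonicSq j), ih,
      legendreTerm_eq_zero (Nat.lt_succ_self m)] at h
    have hZ : altHarmonicSq (m + 1) = altHarmonicSq m + (-1) ^ (m + 1) / ((m : ℚ) + 1) ^ 2 := by
      simp only [altHarmonicSq, Finset.sum_range_succ]
    have hs : ((-1 : ℚ) ^ m) * (-1) ^ m = 1 := by rw [← mul_pow]; norm_num
    have e : (2 : ℚ) / (m + 1) * ((-(m + 1)) / (m + 1) ^ 2) = -2 / (m + 1) ^ 2 := by
      field_simp
    rw [hZ]
    simp only [mul_zero, zero_mul, add_zero] at h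
    rw [e] at h
    rw [pow_succ, pow_succ] at *
    linear_combination h + 2 / ((m : ℚ) + 1) ^ 2 * hs

/-! ### Congruences between p-integral rationals -/

/-- The rational numbers whose denominator is coprime to `p`. -/
def pIntegral (p : ℕ) : Subring ℚ where
  carrier := {q | q.den.Coprime p}
  mul_mem' {a b} ha hb := Nat.Coprime.of_dvd_left (Rat.mul_den_dvd a b) (Nat.Coprime.mul_left ha hb)
  add_mem' {a b} ha hb := Nat.Coprime.of_dvd_left (Rat.add_den_dvd a b) (Nat.Coprime.mul_left ha hb)
  one_mem' := by simp
  zero_mem' := by simp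
  neg_mem' {a} ha := by simpa using ha

theorem inv_natCast_mem_pIntegral {p n : ℕ} (h : n.Coprime p) : (n : ℚ)⁻¹ ∈ pIntegral p := by
  change ((n : ℚ)⁻¹).den.Coprime p
  rw [Rat.inv_natCast_den]
  split_ifs with h0
  · simp
  · exact h

/-- Congruence modulo `p ^ k` in the ring of `p`-integral rationals. -/
def PowModEq (p k : ℕ) (x y : ℚ) : Prop := ∃ z ∈ pIntegral p, x - y = (p : ℚ) ^ k * z

namespace PowModEq

variable {p k : ℕ} {x y z w : ℚ}

theorem refl (x : ℚ) : PowModEq p k x x := ⟨0, zero_mem _, by simp⟩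

theorem of_eq (h : x = y) : PowModEq p k x y := h ▸ refl x

theorem symm : PowModEq p k x y → PowModEq p k y x := by
  rintro ⟨a, ha, h⟩
  exact ⟨-a, neg_mem ha, by linear_combination -h⟩

theorem trans : PowModEq p k x y → PowModEq p k y z → PowModEq p k x z := by
  rintro ⟨a, ha, h⟩ ⟨b, hb, h'⟩
  exact ⟨a + b, add_mem ha hb, by linear_combination h + h'⟩

theorem add : PowModEq p k x y → PowModEq p k z w → PowModEq p k (x + z) (y + w) := by
  rintro ⟨a, ha, h⟩ ⟨b, hb, h'⟩
  exact ⟨a + b, add_mem ha hb, by linear_combination h + h'⟩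

theorem mul_left (hz : z ∈ pIntegral p) : PowModEq p k x y → PowModEq p k (z * x) (z * y) := by
  rintro ⟨a, ha, h⟩
  exact ⟨z * a, mul_mem hz ha, by linear_combination z * h⟩

theorem mul_right (hz : z ∈ pIntegral p) : PowModEq p k x y → PowModEq p k (x * z) (y * z) := by
  rintro ⟨a, ha, h⟩
  exact ⟨a * z, mul_mem ha hz, by linear_combination z * h⟩

theorem mul (hx : x ∈ pIntegral p) (hw : w ∈ pIntegral p) (h : PowModEq p k x y)
    (h' : PowModEq p k z w) : PowModEq p k (x * z) (y * w) :=
  (h'.mul_left hx).trans (h.mul_right hw)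

theorem pow_mul (l : ℕ) : PowModEq p k x y → PowModEq p (k + l) ((p : ℚ) ^ l * x) (p ^ l * y) := by
  rintro ⟨a, ha, h⟩
  exact ⟨a, ha, by rw [pow_add]; linear_combination (p : ℚ) ^ l * h⟩

theorem sum {ι : Type*} (s : Finset ι) (f g : ι → ℚ) (h : ∀ i ∈ s, PowModEq p k (f i) (g i)) :
    PowModEq p k (∑ i ∈ s, f i) (∑ i ∈ s, g i) := by
  classical
  induction s using Finset.induction_on with
  | empty => exact refl _
  | insert a s ha ih =>
    rw [Finset.sum_insert ha, Finset.sum_insert ha]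
    exact (h a (Finset.mem_insert_self a s)).add
      (ih fun i hi => h i (Finset.mem_insert_of_mem hi))

theorem of_intCast {a b : ℤ} (h : (a : ZMod p) = b) : PowModEq p 1 a b := by
  obtain ⟨c, hc⟩ := (ZMod.intCast_eq_intCast_iff_dvd_sub b a p).1 h.symm
  refine ⟨c, intCast_mem _ c, ?_⟩
  rw [pow_one]
  exact_mod_cast hc

/-- A product of factors `1 + p ^ 2 * a` is determined modulo `p ^ 3` by the sum of the `a`. -/
theorem prod_one_add_sq_mul {ι : Type*} (s : Finset ι) (f : ι → ℚ) (h : ∀ i ∈ s, f i ∈ pIntegral p) :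
    PowModEq p 3 (∏ i ∈ s, (1 + (p : ℚ) ^ 2 * f i)) (1 + (p : ℚ) ^ 2 * ∑ i ∈ s, f i) := by
  classical
  induction s using Finset.induction_on with
  | empty => exact of_eq (by simp)
  | insert a s ha ih =>
    rw [Finset.prod_insert ha, Finset.sum_insert ha]
    have ha' := h a (Finset.mem_insert_self a s)
    have hs : ∀ i ∈ s, f i ∈ pIntegral p := fun i hi => h i (Finset.mem_insert_of_mem hi)
    have hp : (p : ℚ) ∈ pIntegral p := natCast_mem _ p
    refine ((ih hs).mul_left (add_mem (one_mem _) (mul_mem (pow_mem hp 2) ha'))).trans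
      ⟨p * f a * ∑ i ∈ s, f i, mul_mem (mul_mem hp ha') (sum_mem hs), ?_⟩
    ring

end PowModEq

/-! ### Power sums modulo p -/

theorem powModEq_pow_sub_three {p : ℕ} [Fact p.Prime] (hp : 5 ≤ p) {i : ℕ} (h : i.Coprime p) :
    PowModEq p 1 ((i : ℚ) ^ (p - 3)) (1 / (i : ℚ) ^ 2) := by
  have hi : (i : ZMod p) ≠ 0 := by
    intro h0
    rw [ZMod.natCast_eq_zero_iff] at h0
    exact (Fact.out : p.Prime).one_lt.ne' (Nat.Coprime.eq_one_of_dvd h.symm h0)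
  have hi' : (i : ℚ) ≠ 0 := by
    rintro h0
    exact hi (by rw [Nat.cast_eq_zero.1 h0, Nat.cast_zero])
  have h1 : PowModEq p 1 ((((i : ℤ) ^ (p - 1) : ℤ)) : ℚ) ((1 : ℤ) : ℚ) := by
    apply PowModEq.of_intCast
    push_cast
    exact ZMod.pow_card_sub_one_eq_one hi
  have h2 := h1.mul_right (pow_mem (inv_natCast_mem_pIntegral h) 2)
  push_cast at h2
  rw [show p - 1 = p - 3 + 2 by omega, pow_add] at h2
  have e : (i : ℚ) ^ (p - 3) * i ^ 2 * (i : ℚ)⁻¹ ^ 2 = (i : ℚ) ^ (p - 3) := by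
    field_simp
  rw [e] at h2
  simpa using h2

theorem coprime_of_pos_of_lt {p i : ℕ} (hp : p.Prime) (h0 : 0 < i) (h : i < p) : i.Coprime p :=
  (Nat.coprime_of_lt_prime h0.ne' h hp).symm

theorem ZMod.sum_range_pow_eq_zero (p r : ℕ) [Fact p.Prime] (hr : r < p - 1) :
    ∑ i ∈ Finset.range p, (i : ZMod p) ^ r = 0 := by
  have h := FiniteField.sum_pow_lt_card_sub_one (ZMod p) r (by rwa [ZMod.card])
  rw [← h]
  refine Finset.sum_nbij (fun i => (i : ZMod p)) (fun _ _ => Finset.mem_univ _) ?_ ?_ fun _ _ => rfl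
  · intro a ha b hb hab
    have ha := Finset.mem_range.1 ha
    have hb := Finset.mem_range.1 hb
    have := (ZMod.natCast_eq_natCast_iff' a b p).1 hab
    rwa [Nat.mod_eq_of_lt ha, Nat.mod_eq_of_lt hb] at this
  · intro x _
    exact ⟨x.val, by simpa using ZMod.val_lt x, by simp⟩

theorem ZMod.two_mul_add_one_eq_zero {p m : ℕ} (hm : p = 2 * m + 1) : (2 * (m : ZMod p) + 1) = 0 := by
  have h : ((2 * m + 1 : ℕ) : ZMod p) = 0 := by rw [← hm, ZMod.natCast_self]
  exact_mod_cast h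

/-- As p-3 is even, i ↦ p-i turns twice the half sum into the complete power sum. -/
theorem ZMod.two_mul_sum_half_pow {p m : ℕ} [Fact p.Prime] (hm : p = 2 * m + 1) (hp : 5 ≤ p) :
    2 * ∑ i ∈ Finset.range m, ((i : ZMod p) + 1) ^ (p - 3) = 0 := by
  have h := ZMod.sum_range_pow_eq_zero p (p - 3) (by omega)
  have h0 := ZMod.two_mul_add_one_eq_zero hm
  have hr : Finset.range p = Finset.range (m + m + 1) := by congr 1; omega
  rw [hr, Finset.sum_range_succ', Finset.sum_range_add, Nat.cast_zero, zero_pow (by omega),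
    add_zero] at h
  rw [two_mul]
  nth_rewrite 2 [← Finset.sum_range_reflect]
  rw [← h]
  congr 1
  · simp
  · refine Finset.sum_congr rfl fun i hi => ?_
    have hi := Finset.mem_range.1 hi
    have ev : Even (p - 3) := ⟨m - 1, by omega⟩
    rw [← ev.neg_pow, Nat.sub_sub, Nat.cast_sub (by omega)]
    congr 1
    push_cast
    linear_combination -h0

theorem inv_add_one_mem_pIntegral {p m i : ℕ} [Fact p.Prime] (hm : p = 2 * m + 1) (hi : i < m) :
    ((i : ℚ) + 1)⁻¹ ∈ pIntegral p := by
  have := inv_natCast_mem_pIntegral (coprime_of_pos_of_lt (Fact.out : p.Prime) i.succ_pos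
    (show i.succ < p by omega))
  simpa using this

theorem inv_two_mem_pIntegral {p m : ℕ} (hm : p = 2 * m + 1) : (2 : ℚ)⁻¹ ∈ pIntegral p := by
  have := inv_natCast_mem_pIntegral (p := p) (n := 2)
    ((Nat.coprime_two_left).2 ⟨m, hm⟩)
  simpa using this

theorem harmonicSq_half_powModEq_zero {p m : ℕ} [Fact p.Prime] (hm : p = 2 * m + 1) (hp : 5 ≤ p) :
    PowModEq p 1 (harmonicSq m) 0 := by
  have h1 : PowModEq p 1 (∑ i ∈ Finset.range m, ((i : ℚ) + 1) ^ (p - 3)) (harmonicSq m) := by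
    refine PowModEq.sum _ _ _ fun i hi => ?_
    have hi := Finset.mem_range.1 hi
    have := powModEq_pow_sub_three hp (coprime_of_pos_of_lt (Fact.out : p.Prime) i.succ_pos
      (show i.succ < p by omega))
    simpa using this
  have h2 : PowModEq p 1 ((2 * ∑ i ∈ Finset.range m, ((i : ℤ) + 1) ^ (p - 3) : ℤ) : ℚ) ((0 : ℤ) : ℚ) := by
    apply PowModEq.of_intCast
    push_cast
    exact ZMod.two_mul_sum_half_pow hm hp
  have h3 := h2.mul_left (inv_two_mem_pIntegral hm)
  push_cast at h3
  rw [← mul_assoc, inv_mul_cancel₀ two_ne_zero, one_mul, mul_zero] at h3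
  exact h1.symm.trans h3

/-! ### Euler numbers and alternating power sums -/

open PowerSeries in
theorem factorial_mul_coeff_mul (F G : ℚ⟦X⟧) (n : ℕ) :
    (n.factorial : ℚ) * coeff n (F * G) = ∑ i ∈ Finset.range (n + 1), (n.choose i : ℚ)
      * (i.factorial * coeff i F) * ((n - i).factorial * coeff (n - i) G) := by
  rw [coeff_mul, Finset.Nat.sum_antidiagonal_eq_sum_range_succ_mk, Finset.mul_sum]
  refine Finset.sum_congr rfl fun i hi => ?_
  have hi : i ≤ n := Nat.lt_succ_iff.1 (Finset.mem_range.1 hi)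
  have h : (n.choose i : ℚ) * i.factorial * (n - i).factorial = n.factorial := by
    exact_mod_cast Nat.choose_mul_factorial_mul_factorial hi
  rw [← h]
  ring

open PowerSeries in
theorem factorial_mul_coeff_rescale_exp (c : ℚ) (n : ℕ) :
    (n.factorial : ℚ) * coeff n (rescale c (exp ℚ)) = c ^ n := by
  have : ((n.factorial : ℕ) : ℚ) ≠ 0 := by exact_mod_cast n.factorial_ne_zero
  rw [coeff_rescale, coeff_exp]
  simp only [eq_ratCast, Rat.cast_id]
  field_simp

open PowerSeries in
/-- The exponential generating function of the Euler numbers. -/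
noncomputable def eulerSeries : ℚ⟦X⟧ := 2 * (exp ℚ + evalNegHom (exp ℚ))⁻¹

open PowerSeries in
theorem eulerSeries_mul :
    eulerSeries * (rescale (1 : ℚ) (exp ℚ) + rescale (-1 : ℚ) (exp ℚ)) = 2 := by
  have h : (exp ℚ + evalNegHom (exp ℚ)) = rescale (1 : ℚ) (exp ℚ) + rescale (-1 : ℚ) (exp ℚ) := by
    rw [rescale_one]; rfl
  rw [eulerSeries, h, mul_assoc, PowerSeries.inv_mul_cancel, mul_one]
  rw [map_add, ← coeff_zero_eq_constantCoeff_apply, ← coeff_zero_eq_constantCoeff_apply,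
    coeff_rescale, coeff_rescale]
  norm_num [coeff_exp]

open PowerSeries in
-- The defining product expresses 2E_n through earlier Euler numbers with integer coefficients, so
-- only powers of 2 enter denominators.
theorem eulerNumber_mem_pIntegral {p m : ℕ} (hm : p = 2 * m + 1) (n : ℕ) :
    eulerNumber n ∈ pIntegral p := by
  induction n using Nat.strong_induction_on with
  | _ n ih =>
    have h := congrArg (fun F : ℚ⟦X⟧ => (n.factorial : ℚ) * coeff n F) eulerSeries_mul
    rw [factorial_mul_coeff_mul, Finset.sum_range_succ] at h
    simp only [map_add, mul_add ((Nat.factorial _ : ℕ) : ℚ), factorial_mul_coeff_rescale_exp] at h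
    have h2 : ((n.factorial : ℕ) : ℚ) * coeff n (2 : ℚ⟦X⟧) ∈ pIntegral p := by
      refine mul_mem (natCast_mem _ _) ?_
      rw [show (2 : ℚ⟦X⟧) = C (2 : ℚ) from (map_ofNat C 2).symm, coeff_C]
      split_ifs
      · exact ofNat_mem _ 2
      · exact zero_mem _
    have h1 : ∑ i ∈ Finset.range n, (n.choose i : ℚ) * (i.factorial * coeff i eulerSeries)
        * (1 ^ (n - i) + (-1) ^ (n - i)) ∈ pIntegral p := by
      refine sum_mem fun i hi => mul_mem (mul_mem (natCast_mem _ _) ?_) ?_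
      · exact ih i (Finset.mem_range.1 hi)
      · exact add_mem (pow_mem (one_mem _) _) (pow_mem (neg_mem (one_mem _)) _)
    have h3 : eulerNumber n = 2⁻¹ * ((n.factorial : ℚ) * coeff n (2 : ℚ⟦X⟧)
        - ∑ i ∈ Finset.range n, (n.choose i : ℚ) * (i.factorial * coeff i eulerSeries)
        * (1 ^ (n - i) + (-1) ^ (n - i))) := by
      rw [← h]
      simp only [Nat.choose_self, Nat.sub_self, pow_zero]
      change _ = 2⁻¹ * (_ + ((1 : ℕ) : ℚ) * eulerNumber n * (1 + 1) - _)
      push_cast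
      ring
    rw [h3]
    exact mul_mem (inv_two_mem_pIntegral hm) (sub_mem h2 h1)

open PowerSeries in
theorem sum_rescale_exp_mul (n : ℕ) :
    (∑ k ∈ Finset.range n, (-1 : ℚ⟦X⟧) ^ k * rescale (2 * (k : ℚ) + 1) (exp ℚ))
      * (rescale (1 : ℚ) (exp ℚ) + rescale (-1 : ℚ) (exp ℚ))
      = 1 - (-1) ^ n * rescale (2 * (n : ℚ)) (exp ℚ) := by
  induction n with
  | zero => simp
  | succ n ih =>
    have h1 : rescale (2 * (n : ℚ) + 1) (exp ℚ) * rescale (1 : ℚ) (exp ℚ)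
        = rescale (2 * ((n + 1 : ℕ) : ℚ)) (exp ℚ) := by
      rw [exp_mul_exp_eq_exp_add]
      congr 2
      push_cast
      ring
    have h2 : rescale (2 * (n : ℚ) + 1) (exp ℚ) * rescale (-1 : ℚ) (exp ℚ)
        = rescale (2 * (n : ℚ)) (exp ℚ) := by
      rw [exp_mul_exp_eq_exp_add]
      congr 2
      ring
    rw [Finset.sum_range_succ, add_mul, ih, pow_succ]
    linear_combination (-1 : ℚ⟦X⟧) ^ n * (h1 + h2)

open PowerSeries in
-- Multiplying the geometric sum `sum_rescale_exp_mul` by the Euler series gives twice the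
-- exponential sum as E(x)(1 + e^(2px)) for odd p.
theorem two_mul_sum_odd_pow_eq {p : ℕ} (hp : Odd p) (r : ℕ) :
    2 * ∑ k ∈ Finset.range p, (-1 : ℚ) ^ k * (2 * (k : ℚ) + 1) ^ r
      = eulerNumber r + ∑ i ∈ Finset.range (r + 1), (r.choose i : ℚ) * eulerNumber i
        * (2 * (p : ℚ)) ^ (r - i) := by
  have h : (∑ k ∈ Finset.range p, (-1 : ℚ⟦X⟧) ^ k * rescale (2 * (k : ℚ) + 1) (exp ℚ)) * 2
      = eulerSeries + eulerSeries * rescale (2 * (p : ℚ)) (exp ℚ) := by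
    have h1 := sum_rescale_exp_mul p
    rw [hp.neg_one_pow] at h1
    rw [← eulerSeries_mul]
    linear_combination eulerSeries * h1
  have h := congrArg (fun F : ℚ⟦X⟧ => (r.factorial : ℚ) * coeff r F) h
  simp only [map_add, mul_add, factorial_mul_coeff_mul _ (rescale _ _),
    factorial_mul_coeff_rescale_exp] at h
  refine Eq.trans ?_ h
  rw [show (2 : ℚ⟦X⟧) = C (2 : ℚ) from (map_ofNat C 2).symm, coeff_mul_C, map_sum, mul_comm, ← mul_assoc,
    Finset.mul_sum]
  congr 1
  refine Finset.sum_congr rfl fun k _ => ?_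
  rw [show (-1 : ℚ⟦X⟧) ^ k = C ((-1 : ℚ) ^ k) by rw [map_pow, map_neg, map_one],
    coeff_C_mul, ← factorial_mul_coeff_rescale_exp (2 * (k : ℚ) + 1) r]
  ring

theorem eulerNumber_powModEq_sum {p m : ℕ} (hm : p = 2 * m + 1) (r : ℕ) :
    PowModEq p 1 (2 * ∑ k ∈ Finset.range p, (-1 : ℚ) ^ k * (2 * (k : ℚ) + 1) ^ r)
      (2 * eulerNumber r) := by
  rw [two_mul_sum_odd_pow_eq ⟨m, hm⟩, Finset.sum_range_succ]
  have h : PowModEq p 1 (∑ i ∈ Finset.range r, (r.choose i : ℚ) * eulerNumber i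
        * (2 * (p : ℚ)) ^ (r - i)) (∑ i ∈ Finset.range r, 0) := by
    refine PowModEq.sum _ _ _ fun i hi => ?_
    have hi := Finset.mem_range.1 hi
    obtain ⟨d, hd⟩ : ∃ d, r - i = d + 1 := ⟨r - i - 1, by omega⟩
    refine ⟨(r.choose i : ℚ) * eulerNumber i * ((2 * (p : ℚ)) ^ d * 2), ?_, ?_⟩
    · have h2 : (2 : ℚ) ∈ pIntegral p := ofNat_mem _ 2
      exact mul_mem (mul_mem (natCast_mem _ _) (eulerNumber_mem_pIntegral hm i))
        (mul_mem (pow_mem (mul_mem h2 (natCast_mem _ _)) _) h2)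
    · rw [hd, pow_succ]
      ring
  have h' := ((PowModEq.refl (eulerNumber r)).add
    (h.add (PowModEq.refl ((r.choose r : ℚ) * eulerNumber r * (2 * (p : ℚ)) ^ (r - r)))))
  refine h'.trans (PowModEq.of_eq ?_)
  simp only [Finset.sum_const_zero, Nat.choose_self, Nat.sub_self, pow_zero]
  push_cast
  ring

/-- The term k = m is p, hence zero; k = m±i both give (-1)^(m+i) (2i)^(p-3), and the total factor
4·2^(p-3) is 1 by Fermat. -/
theorem ZMod.two_mul_sum_odd_pow {p m : ℕ} [Fact p.Prime] (hm : p = 2 * m + 1) (hp : 5 ≤ p) :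
    2 * ∑ k ∈ Finset.range p, (-1 : ZMod p) ^ k * (2 * (k : ZMod p) + 1) ^ (p - 3)
      = (-1) ^ m * ∑ i ∈ Finset.range m, (-1 : ZMod p) ^ (i + 1) * ((i : ZMod p) + 1) ^ (p - 3) := by
  have h0 := ZMod.two_mul_add_one_eq_zero hm
  have ev : Even (p - 3) := ⟨m - 1, by omega⟩
  have h2 : (2 : ZMod p) ≠ 0 := by
    intro h
    have : ((2 : ℕ) : ZMod p) = 0 := by exact_mod_cast h
    rw [ZMod.natCast_eq_zero_iff] at this
    exact absurd (Nat.le_of_dvd two_pos this) (by omega)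
  have hF : (2 : ZMod p) ^ (p - 3) * 4 = 1 := by
    have := ZMod.pow_card_sub_one_eq_one h2
    rw [show p - 1 = p - 3 + 2 by omega, pow_add] at this
    linear_combination this
  set f : ℕ → ZMod p := fun k => (-1) ^ k * (2 * (k : ZMod p) + 1) ^ (p - 3) with hf
  have hlow : ∑ k ∈ Finset.range m, f k = (-1) ^ m * 2 ^ (p - 3)
      * ∑ i ∈ Finset.range m, (-1 : ZMod p) ^ (i + 1) * ((i : ZMod p) + 1) ^ (p - 3) := by
    rw [← Finset.sum_range_reflect, Finset.mul_sum]
    refine Finset.sum_congr rfl fun i hi => ?_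
    have hi := Finset.mem_range.1 hi
    have e1 : (-1 : ZMod p) ^ (m - 1 - i) = (-1) ^ m * (-1) ^ (i + 1) := by
      rw [← pow_add, show m + (i + 1) = (m - 1 - i) + 2 * (i + 1) by omega, pow_add, pow_mul]
      simp
    have e2 : (2 * ((m - 1 - i : ℕ) : ZMod p) + 1) ^ (p - 3)
        = 2 ^ (p - 3) * ((i : ZMod p) + 1) ^ (p - 3) := by
      rw [← mul_pow, ← ev.neg_pow, Nat.sub_sub, Nat.cast_sub (by omega)]
      congr 1
      push_cast
      linear_combination -h0
    simp only [hf]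
    rw [e1, e2]
    ring
  have hhigh : ∑ k ∈ Finset.range m, f (m + (k + 1)) = ∑ k ∈ Finset.range m, f k := by
    rw [← Finset.sum_range_reflect]
    refine Finset.sum_congr rfl fun i hi => ?_
    have hi := Finset.mem_range.1 hi
    simp only [hf]
    have e1 : (-1 : ZMod p) ^ (m + (m - 1 - i + 1)) = (-1) ^ i := by
      rw [show m + (m - 1 - i + 1) = 2 * (m - i) + i by omega, pow_add, pow_mul]
      simp
    rw [e1, ← ev.neg_pow, show m - 1 - i + 1 = m - i by omega]
    push_cast [Nat.cast_sub hi.le]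
    congr 2
    linear_combination -2 * h0
  have hmid : f m = 0 := by
    simp only [hf, h0]
    rw [zero_pow (by omega), mul_zero]
  have hr : Finset.range p = Finset.range (m + (m + 1)) := by congr 1; omega
  change 2 * ∑ k ∈ Finset.range p, f k = _
  rw [hr, Finset.sum_range_add, Finset.sum_range_succ', add_zero, hmid, hhigh, hlow]
  linear_combination (-1) ^ m
    * (∑ i ∈ Finset.range m, (-1 : ZMod p) ^ (i + 1) * ((i : ZMod p) + 1) ^ (p - 3)) * hF

theorem altHarmonicSq_powModEq_eulerNumber {p m : ℕ} [Fact p.Prime] (hm : p = 2 * m + 1)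
    (hp : 5 ≤ p) : PowModEq p 1 (altHarmonicSq m) ((-1) ^ m * 2 * eulerNumber (p - 3)) := by
  have hs : ((-1 : ℚ) ^ m) * (-1) ^ m = 1 := by rw [← mul_pow]; norm_num
  have h1 : PowModEq p 1 (∑ i ∈ Finset.range m, (-1 : ℚ) ^ (i + 1) * ((i : ℚ) + 1) ^ (p - 3))
      (altHarmonicSq m) := by
    refine PowModEq.sum _ _ _ fun i hi => ?_
    have hi := Finset.mem_range.1 hi
    have := powModEq_pow_sub_three hp (coprime_of_pos_of_lt (Fact.out : p.Prime) i.succ_pos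
      (show i.succ < p by omega))
    have := this.mul_left (pow_mem (neg_mem (one_mem (pIntegral p))) (i + 1))
    simpa [div_eq_mul_inv] using this
  have h2 : PowModEq p 1
      ((2 * ∑ k ∈ Finset.range p, (-1 : ℤ) ^ k * (2 * (k : ℤ) + 1) ^ (p - 3) : ℤ) : ℚ)
      (((-1) ^ m * ∑ i ∈ Finset.range m, (-1 : ℤ) ^ (i + 1) * ((i : ℤ) + 1) ^ (p - 3) : ℤ) : ℚ) := by
    apply PowModEq.of_intCast
    push_cast
    exact ZMod.two_mul_sum_odd_pow hm hp
  have hn : ((-1 : ℚ) ^ m) ∈ pIntegral p := pow_mem (neg_mem (one_mem _)) m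
  push_cast at h2
  have h3 := (h2.symm.trans (eulerNumber_powModEq_sum hm (p - 3))).mul_left hn
  rw [← mul_assoc, hs, one_mul, ← mul_assoc] at h3
  exact h1.symm.trans h3

/-! ### The congruence modulo p^3 -/

theorem four_inv_pow_mem_pIntegral {p m : ℕ} (hm : p = 2 * m + 1) (j : ℕ) :
    ((4 : ℚ) ^ j)⁻¹ ∈ pIntegral p := by
  rw [← inv_pow, show (4 : ℚ)⁻¹ = 2⁻¹ * 2⁻¹ by norm_num]
  exact pow_mem (mul_mem (inv_two_mem_pIntegral hm) (inv_two_mem_pIntegral hm)) j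

theorem inv_even_sub_mem_pIntegral {p m : ℕ} [Fact p.Prime] (hm : p = 2 * m + 1) {i : ℕ} (hi : i < m) :
    (2 * ((i : ℚ) + 1) - p)⁻¹ ∈ pIntegral p := by
  have h := inv_natCast_mem_pIntegral (coprime_of_pos_of_lt (Fact.out : p.Prime)
    (show 0 < p - 2 * (i + 1) by omega) (show p - 2 * (i + 1) < p by omega))
  rw [Nat.cast_sub (by omega)] at h
  push_cast at h
  have h' := neg_mem h
  rwa [← inv_neg, neg_sub] at h'

theorem invProd_succ {p m : ℕ} (hm : p = 2 * m + 1) (j : ℕ) :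
    invProd m (j + 1) = invProd m j * (1 + p * (2 * ((j : ℚ) + 1) - p)⁻¹) := by
  have hne := two_mul_succ_sub_odd_ne_zero m j
  have h : invProd m (j + 1) = invProd m j * (1 - (2 * m + 1 : ℕ) / (2 * ((j : ℚ) + 1)))⁻¹ :=
    Finset.prod_range_succ _ _
  rw [h, inv_one_sub_half, ← hm]
  rw [← hm] at hne
  congr 1
  field_simp
  ring

theorem invProd_mem_pIntegral {p m : ℕ} [Fact p.Prime] (hm : p = 2 * m + 1) {j : ℕ} (hj : j ≤ m) :
    invProd m j ∈ pIntegral p := by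
  induction j with
  | zero => simp [invProd]
  | succ j ih =>
    rw [invProd_succ hm]
    exact mul_mem (ih (by omega)) (add_mem (one_mem _)
      (mul_mem (natCast_mem _ _) (inv_even_sub_mem_pIntegral hm (by omega))))

theorem invProd_powModEq_one {p m : ℕ} [Fact p.Prime] (hm : p = 2 * m + 1) {j : ℕ} (hj : j ≤ m) :
    PowModEq p 1 (invProd m j) 1 := by
  induction j with
  | zero => exact .of_eq (by simp [invProd])
  | succ j ih =>
    refine PowModEq.trans ?_ (ih (by omega))
    rw [invProd_succ hm]
    exact ⟨invProd m j * (2 * ((j : ℚ) + 1) - p)⁻¹, mul_mem (invProd_mem_pIntegral hm (by omega))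
      (inv_even_sub_mem_pIntegral hm (by omega)), by ring⟩

theorem halfTerm_mem_pIntegral {p m : ℕ} (hm : p = 2 * m + 1) (j : ℕ) : halfTerm m j ∈ pIntegral p :=
  mul_mem (mul_mem (pow_mem (neg_mem (one_mem _)) j) (natCast_mem _ _))
    (mul_mem (natCast_mem _ _) (four_inv_pow_mem_pIntegral hm j))

theorem harmonicSq_mem_pIntegral {p m : ℕ} [Fact p.Prime] (hm : p = 2 * m + 1) {j : ℕ} (hj : j ≤ m) :
    harmonicSq j ∈ pIntegral p := by
  refine sum_mem fun i hi => ?_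
  have hi := Finset.mem_range.1 hi
  rw [one_div, ← inv_pow]
  exact pow_mem (inv_add_one_mem_pIntegral hm (by omega)) 2

/-- Since m ≡ -1/2 mod p, the ratio (m+j+1)/(j+1) agrees with (2j+1)/(2(j+1)). -/
theorem choose_add_powModEq_centralBinom {p m : ℕ} [Fact p.Prime] (hm : p = 2 * m + 1) {j : ℕ} (hj : j ≤ m) :
    PowModEq p 1 ((m + j).choose j : ℚ) (j.centralBinom / 4 ^ j) := by
  induction j with
  | zero => exact .of_eq (by simp)
  | succ j ih =>
    have hi := inv_add_one_mem_pIntegral hm (show j < m by omega)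
    have hj1 : ((j : ℚ) + 1) ≠ 0 := by positivity
    have e1 : ((m + (j + 1)).choose (j + 1) : ℚ)
        = (m + j + 1 : ℕ) * ((j : ℚ) + 1)⁻¹ * (m + j).choose j := by
      rw [← add_assoc, choose_succ_succ_rat]
      push_cast
      ring
    have e2 : ((j + 1).centralBinom : ℚ) / 4 ^ (j + 1)
        = ((2 * j + 1 : ℕ) * 2⁻¹ * ((j : ℚ) + 1)⁻¹) * (j.centralBinom / 4 ^ j) := by
      rw [centralBinom_succ_rat]
      push_cast
      field_simp
      ring
    rw [e1, e2]
    refine PowModEq.mul (mul_mem (natCast_mem _ _) hi)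
      (mul_mem (natCast_mem _ _) (four_inv_pow_mem_pIntegral hm j)) ?_ (ih (by omega))
    refine ⟨2⁻¹ * ((j : ℚ) + 1)⁻¹, mul_mem (inv_two_mem_pIntegral hm) hi, ?_⟩
    rw [hm]
    push_cast
    ring

theorem sum_halfTerm_mul_harmonicSq_powModEq {p m : ℕ} [Fact p.Prime] (hm : p = 2 * m + 1) :
    PowModEq p 1 (∑ j ∈ Finset.range (m + 1), halfTerm m j * harmonicSq j)
      ((-1) ^ (m + 1) * 2 * altHarmonicSq m) := by
  rw [← sum_legendreTerm_mul_harmonicSq]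
  refine PowModEq.sum _ _ _ fun j hj => ?_
  have hj : j ≤ m := Nat.lt_succ_iff.1 (Finset.mem_range.1 hj)
  refine PowModEq.mul_right (harmonicSq_mem_pIntegral hm hj) ?_
  exact (choose_add_powModEq_centralBinom hm hj).symm.mul_left
    (mul_mem (pow_mem (neg_mem (one_mem _)) j) (natCast_mem _ _))

theorem prod_powModEq {p m : ℕ} [Fact p.Prime] (hm : p = 2 * m + 1) {j : ℕ} (hj : j ≤ m) :
    PowModEq p 3 (∏ i ∈ Finset.range j, ((1 + p / ((i : ℚ) + 1)) * (1 - p / (2 * ((i : ℚ) + 1)))))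
      (invProd m j + p ^ 2 * (-(3 / 4) * harmonicSq j)) := by
  have h4 : (4 : ℚ)⁻¹ ∈ pIntegral p := by simpa using four_inv_pow_mem_pIntegral hm 1
  have hp : (p : ℚ) ∈ pIntegral p := natCast_mem _ p
  have h3 : (3 : ℚ) ∈ pIntegral p := ofNat_mem _ 3
  have hinv : ∀ i ∈ Finset.range j, ((i : ℚ) + 1)⁻¹ ∈ pIntegral p := fun i hi =>
    inv_add_one_mem_pIntegral hm (by have := Finset.mem_range.1 hi; omega)
  -- From (1+x)(1-x/2)^2 = 1 - 3x^2/4 + x^3/4 at x = p/(i+1).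
  set f : ℕ → ℚ := fun i =>
    -(3 * 4⁻¹ * (((i : ℚ) + 1)⁻¹) ^ 2) + p * (4⁻¹ * (((i : ℚ) + 1)⁻¹) ^ 3) with hf
  have hfi : ∀ i ∈ Finset.range j, f i ∈ pIntegral p := fun i hi =>
    add_mem (neg_mem (mul_mem (mul_mem h3 h4) (pow_mem (hinv i hi) 2)))
      (mul_mem hp (mul_mem h4 (pow_mem (hinv i hi) 3)))
  have e : ∏ i ∈ Finset.range j, ((1 + p / ((i : ℚ) + 1)) * (1 - p / (2 * ((i : ℚ) + 1))))
      = invProd m j * ∏ i ∈ Finset.range j, (1 + (p : ℚ) ^ 2 * f i) := by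
    rw [invProd, ← Finset.prod_mul_distrib]
    refine Finset.prod_congr rfl fun i _ => ?_
    have h1 := one_sub_half_ne_zero m i
    have hi : ((i : ℚ) + 1) ≠ 0 := by positivity
    rw [← hm] at h1 ⊢
    rw [eq_inv_mul_iff_mul_eq₀ h1]
    simp only [hf]
    field_simp
    ring
  have hQ := invProd_mem_pIntegral hm hj
  have hfs : PowModEq p 1 (∑ i ∈ Finset.range j, f i) (-(3 / 4) * harmonicSq j) := by
    rw [harmonicSq, Finset.mul_sum]
    refine PowModEq.sum _ _ _ fun i hi => ⟨4⁻¹ * (((i : ℚ) + 1)⁻¹) ^ 3,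
      mul_mem h4 (pow_mem (hinv i hi) 3), ?_⟩
    simp only [hf, one_div, inv_pow]
    ring
  have h1 := (PowModEq.prod_one_add_sq_mul _ f hfi).mul_left hQ
  have h2 := (((invProd_powModEq_one hm hj).mul_right (sum_mem hfi)).trans
    (PowModEq.of_eq (one_mul _) |>.trans hfs)).pow_mul 2
  rw [e]
  refine h1.trans ((PowModEq.of_eq ?_).trans ((PowModEq.refl (invProd m j)).add h2))
  ring

theorem sum_prod_powModEq {p m : ℕ} [Fact p.Prime] (hm : p = 2 * m + 1) :
    PowModEq p 3 (∑ j ∈ Finset.range (m + 1), halfTerm m j * ∏ i ∈ Finset.range j,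
        ((1 + p / ((i : ℚ) + 1)) * (1 - p / (2 * ((i : ℚ) + 1)))))
      ((-1) ^ m * invProd m m + p ^ 2 * (3 / 2 * (-1) ^ m * altHarmonicSq m)) := by
  have h1 : PowModEq p 3 (∑ j ∈ Finset.range (m + 1), halfTerm m j * ∏ i ∈ Finset.range j,
        ((1 + p / ((i : ℚ) + 1)) * (1 - p / (2 * ((i : ℚ) + 1)))))
      (∑ j ∈ Finset.range (m + 1), halfTerm m j
        * (invProd m j + p ^ 2 * (-(3 / 4) * harmonicSq j))) :=
    PowModEq.sum _ _ _ fun j hj => (prod_powModEq hm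
      (Nat.lt_succ_iff.1 (Finset.mem_range.1 hj))).mul_left (halfTerm_mem_pIntegral hm j)
  have h4 : (4 : ℚ)⁻¹ ∈ pIntegral p := by simpa using four_inv_pow_mem_pIntegral hm 1
  have h3 : (3 : ℚ) ∈ pIntegral p := ofNat_mem _ 3
  have h2 := ((sum_halfTerm_mul_harmonicSq_powModEq hm).mul_left
    (neg_mem (mul_mem h3 h4))).pow_mul 2
  refine h1.trans ((PowModEq.of_eq ?_).trans (((PowModEq.refl ((-1) ^ m * invProd m m)).add
    h2).trans (PowModEq.of_eq ?_)))
  · rw [← sum_halfTerm_mul_invProd, Finset.mul_sum, Finset.mul_sum, ← Finset.sum_add_distrib]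
    exact Finset.sum_congr rfl fun j _ => by ring
  · rw [pow_succ (-1 : ℚ) m]
    ring

/-- By `four_pow_eq` the factors are (1-x)(1-x/2)^(-2) with x = p/i, that is 1 - p^2/(2i-p)^2: no
linear term, and the quadratic terms sum to -H_m/4 ≡ 0 mod p. -/
theorem four_pow_mul_invProd_powModEq_one {p m : ℕ} [Fact p.Prime] (hm : p = 2 * m + 1) (hp : 5 ≤ p) :
    PowModEq p 3 (4 ^ m * invProd m m) 1 := by
  set a : ℕ → ℚ := fun i => (2 * ((i : ℚ) + 1) - p)⁻¹ with ha
  have hai : ∀ i ∈ Finset.range m, a i ∈ pIntegral p := fun i hi =>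
    inv_even_sub_mem_pIntegral hm (Finset.mem_range.1 hi)
  have hgi : ∀ i ∈ Finset.range m, -(a i ^ 2) ∈ pIntegral p := fun i hi =>
    neg_mem (pow_mem (hai i hi) 2)
  have e : (4 : ℚ) ^ m * invProd m m
      = ∏ i ∈ Finset.range m, (1 + (p : ℚ) ^ 2 * -(a i ^ 2)) := by
    rw [four_pow_eq, invProd, mul_assoc, ← Finset.prod_mul_distrib, ← Finset.prod_mul_distrib]
    refine Finset.prod_congr rfl fun i _ => ?_
    have h1 := two_mul_succ_sub_odd_ne_zero m i
    have hi : ((i : ℚ) + 1) ≠ 0 := by positivity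
    rw [inv_one_sub_half, ← hm]
    rw [← hm] at h1
    have key : ∀ q x : ℚ, x ≠ 0 → 2 * x - q ≠ 0 → (1 - q / x) * ((2 * x / (2 * x - q))
        * (2 * x / (2 * x - q))) = 1 + q ^ 2 * -((2 * x - q)⁻¹ ^ 2) := by
      intro q x hx hd
      obtain ⟨d, rfl⟩ : ∃ d, q = 2 * x - d := ⟨2 * x - q, by ring⟩
      rw [sub_sub_cancel] at hd ⊢
      field_simp
      ring
    exact key p _ hi h1
  have h2 := inv_two_mem_pIntegral hm
  have h4 : (4 : ℚ)⁻¹ ∈ pIntegral p := by simpa using four_inv_pow_mem_pIntegral hm 1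
  have hs : PowModEq p 1 (∑ i ∈ Finset.range m, -(a i ^ 2)) (-4⁻¹ * harmonicSq m) := by
    rw [harmonicSq, Finset.mul_sum]
    refine PowModEq.sum _ _ _ fun i hi => ?_
    have hinv := inv_add_one_mem_pIntegral hm (Finset.mem_range.1 hi)
    have h1 := two_mul_succ_sub_odd_ne_zero m i
    rw [← hm] at h1
    have hi1 : ((i : ℚ) + 1) ≠ 0 := by positivity
    -- With b = 1/(2(i+1)), a - b = p a b, so b^2 - a^2 = -p a b (a+b).
    refine ⟨-(a i * 2⁻¹ * ((i : ℚ) + 1)⁻¹ * (a i + 2⁻¹ * ((i : ℚ) + 1)⁻¹)),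
      neg_mem (mul_mem (mul_mem (mul_mem (hai i hi) h2) hinv)
        (add_mem (hai i hi) (mul_mem h2 hinv))), ?_⟩
    simp only [ha]
    field_simp
    ring
  have hz := (hs.trans ((harmonicSq_half_powModEq_zero hm hp).mul_left (neg_mem h4))).pow_mul 2
  rw [e]
  refine (PowModEq.prod_one_add_sq_mul _ _ hgi).trans
    (((PowModEq.refl 1).add hz).trans (PowModEq.of_eq (by ring)))

theorem four_pow_powModEq_one {p m : ℕ} [Fact p.Prime] (hm : p = 2 * m + 1) : PowModEq p 1 ((4 : ℚ) ^ m) 1 := by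
  have h2 : (2 : ZMod p) ≠ 0 := by
    intro h
    have h2 : ((2 : ℕ) : ZMod p) = 0 := by exact_mod_cast h
    rw [ZMod.natCast_eq_zero_iff] at h2
    have h1 := (Nat.prime_dvd_prime_iff_eq (Fact.out : p.Prime) Nat.prime_two).1 h2
    omega
  have h := ZMod.pow_card_sub_one_eq_one h2
  rw [show p - 1 = 2 * m by omega, pow_mul] at h
  have h' : PowModEq p 1 (((4 : ℤ) ^ m : ℤ) : ℚ) ((1 : ℤ) : ℚ) := by
    apply PowModEq.of_intCast
    push_cast
    rw [← h]
    norm_num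
  exact_mod_cast h'

theorem altHarmonicSq_mem_pIntegral {p m : ℕ} [Fact p.Prime] (hm : p = 2 * m + 1) : altHarmonicSq m ∈ pIntegral p := by
  refine sum_mem fun i hi => ?_
  rw [div_eq_mul_inv, ← inv_pow]
  exact mul_mem (pow_mem (neg_mem (one_mem _)) _)
    (pow_mem (inv_add_one_mem_pIntegral hm (Finset.mem_range.1 hi)) 2)

theorem two_pow_mul_sum_powModEq {p m : ℕ} [Fact p.Prime] (hm : p = 2 * m + 1) (hp : 5 ≤ p) :
    PowModEq p 3 (2 ^ p * ∑ j ∈ Finset.range (m + 1), halfTerm m j * ∏ i ∈ Finset.range j,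
        ((1 + p / ((i : ℚ) + 1)) * (1 - p / (2 * ((i : ℚ) + 1)))))
      (2 * (-1) ^ m + p ^ 2 * (6 * eulerNumber (p - 3))) := by
  have hpow : (2 : ℚ) ^ p = 2 * 4 ^ m := by
    rw [hm, pow_succ, pow_mul]
    norm_num
    ring
  have hs : ((-1 : ℚ) ^ m) * (-1) ^ m = 1 := by rw [← mul_pow]; norm_num
  have hsign : ((-1 : ℚ) ^ m) ∈ pIntegral p := pow_mem (neg_mem (one_mem _)) m
  have h2 : (2 : ℚ) ∈ pIntegral p := ofNat_mem _ 2
  have h3 : (3 : ℚ) ∈ pIntegral p := ofNat_mem _ 3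
  have h4 : (4 : ℚ) ∈ pIntegral p := ofNat_mem _ 4
  have hmain := (four_pow_mul_invProd_powModEq_one hm hp).mul_left (mul_mem h2 hsign)
  have hZ := ((four_pow_powModEq_one hm).mul_right
    (mul_mem (mul_mem h3 hsign) (altHarmonicSq_mem_pIntegral hm))).trans
    ((PowModEq.of_eq (one_mul _)).trans
      ((altHarmonicSq_powModEq_eulerNumber hm hp).mul_left (mul_mem h3 hsign)))
  have h := ((sum_prod_powModEq hm).mul_left (mul_mem h2 (pow_mem h4 m)))
  rw [hpow]
  refine h.trans ((PowModEq.of_eq ?_).trans ((hmain.add (hZ.pow_mul 2)).trans (PowModEq.of_eq ?_)))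
  · ring
  · linear_combination (p : ℚ) ^ 2 * 6 * eulerNumber (p - 3) * hs

theorem theorem2 (p : ℕ) (hp : p.Prime) (hp5 : 5 ≤ p) :
    RatModEq (p ^ 4)
      (∑ k ∈ Finset.range p, (3 * (k : ℚ) + 2) / (-2) ^ k * (domb k : ℚ))
      (2 * (p : ℚ) * (-1) ^ ((p - 1) / 2) + 6 * (p : ℚ) ^ 3 * eulerNumber (p - 3)) := by
  have : Fact p.Prime := ⟨hp⟩
  have hodd : Odd p := hp.odd_of_ne_two (by omega)
  obtain ⟨m, hm⟩ := hodd
  have e : ∑ j ∈ Finset.range p, ((p : ℚ) - 2 * j) * tri p j * j.centralBinom / 16 ^ j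
      = p * ∑ j ∈ Finset.range (m + 1), halfTerm m j * ∏ i ∈ Finset.range j,
        ((1 + p / ((i : ℚ) + 1)) * (1 - p / (2 * ((i : ℚ) + 1)))) := by
    rw [Finset.mul_sum]
    symm
    refine (Finset.sum_subset (Finset.range_subset_range.2 (by omega)) ?_).trans
      (Finset.sum_congr rfl fun j _ => ?_)
    · intro j _ hj
      rw [Finset.mem_range] at hj
      simp [halfTerm, Nat.choose_eq_zero_of_lt (show m < j by omega)]
    · have := tri_summand_eq m j
      rw [← hm] at this
      exact this.symm
  -- The factor p common to all summands raises the modulus from p^3 to p^4.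
  obtain ⟨z, hz, h⟩ := (two_pow_mul_sum_powModEq hm hp5).pow_mul 1
  refine ⟨z, Nat.Coprime.pow_right 4 hz, ?_⟩
  rw [sum_domb_eq p ⟨m, hm⟩, e, show (p - 1) / 2 = m by omega]
  push_cast
  linear_combination h
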